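/- Let $d\ge 1$, and let $F$ be a random element of the space of non-negative continuous functions on $\mathbb R^d$ (with the topology of locally uniform convergence), with law $P_F$ and $\mathbb E\int_{\mathbb R^d}F(t)\,dt=1$. Let $$M(s)=\max_{(u,t,f)\in\Pi_0}u\,f(s-t),\qquad s\in\mathbb R^d,$$ be the mixed moving maxima process with shape function $F$, where $\Pi_0$ is a Poisson point process with intensity $u^{-2}\,du\,dt\,P_F(df)$ on $(0,\infty)\times\mathbb R^d\times C(\mathbb R^d)$. For $c,\varepsilon,\kappa>0$ let $\Pi_{c,\varepsilon}$ be a Poisson point process on the same space with intensity $c\,\mathbf 1_{\{u\ge\varepsilon\}}u^{-2}\,du\,dt\,P_F(df)$, and put $$\tilde M(s)=\kappa\vee\max_{(u,t,f)\in\Pi_{c,\varepsilon}}u\,f(s-t),\qquad s\in\mathbb R^d.$$ A process $\eta$ on $\mathbb R^d$ is said to be in the max-domain of attraction (MDA) of a process $\xi$ if there are functions $b_n:\mathbb R^d\to\mathbb R$ and $c_n:\mathbb R^d\to(0,\infty)$ such that, for independent copies $\eta_1,\eta_2,\dots$ of $\eta$, the processes $c_n(\cdot)\bigl(\max_{i\le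 n}\eta_i(\cdot)-b_n(\cdot)\bigr)$ converge to $\xi$ in distribution as $n\to\infty$; the convergence is meant either in the sense of finite-dimensional distributions or in the sense of weak convergence on $C(\mathbb R^d)$ (all processes then having almost surely continuous paths). 1. For every $s\in\mathbb R^d$ the suprema defining $M(s)$ and $\tilde M(s)$ are almost surely finite, and $\tilde M$ is in the MDA of $M$ in the sense of finite-dimensional distributions. 2. If, moreover, $\int_{\mathbb R^d}\mathbb E\bigl\{\max_{t_0\in K}F(t_0-t)\bigr\}\,dt<\infty$ for every compact $K\subset\mathbb R^d$, then almost surely these suprema are finite for all $s\in\mathbb R^d$ simultaneously, and $\tilde M$ is in the MDA of $M$ in the sense of weak convergence on $C(\mathbb R^d)$. -/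

import Mathlib

open MeasureTheory ProbabilityTheory Set Filter Topology
open scoped NNReal ENNReal

/-- A space of continuous functions carries the compact-open topology (locally uniform
convergence) and its Borel sigma-algebra. -/
instance continuousMapMeasurableSpace {X Y : Type*} [TopologicalSpace X] [TopologicalSpace Y] :
    MeasurableSpace C(X, Y) := borel _

instance continuousMapBorelSpace {X Y : Type*} [TopologicalSpace X] [TopologicalSpace Y] :
    BorelSpace C(X, Y) := ⟨rfl⟩

noncomputable section

/-! ### Poisson point processes -/

/-- The random counting measure `∑ i, δ_{X i}`. -/
def countingMeasure {Ω E : Type*} [MeasurableSpace E] (X : ℕ → Ω → E) (ω : Ω) : Measure E :=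
  Measure.sum fun i => Measure.dirac (X i ω)

/-- The points `X 0, X 1, …` form a Poisson point process with (sigma-finite) intensity `μ`:
the number of points in a set `B` of finite intensity is Poisson distributed with parameter `μ B`,
and the numbers of points in pairwise disjoint sets are independent. -/
structure IsPoissonPointProcess {Ω E : Type*} [MeasurableSpace Ω] [MeasurableSpace E]
    (P : Measure Ω) (μ : Measure E) (X : ℕ → Ω → E) : Prop where
  measurable_point : ∀ i, Measurable (X i)
  law_count : ∀ B : Set E, MeasurableSet B → μ B ≠ ∞ →
    P.map (fun ω => countingMeasure X ω B) =
      (poissonMeasure (μ B).toNNReal).map (fun k : ℕ => (k : ℝ≥0∞))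
  indep_count : ∀ (m : ℕ) (B : Fin m → Set E), (∀ j, MeasurableSet (B j)) →
    Pairwise (fun i j => Disjoint (B i) (B j)) →
    iIndepFun (fun j ω => countingMeasure X ω (B j)) P

/-! ### Max-domains of attraction -/

/-- Convergence of real-valued processes, indexed by `T`, in the sense of finite-dimensional
distributions. -/
def TendstoFinDim {T Ω' : Type*} {Ω : ℕ → Type*} [∀ n, MeasurableSpace (Ω n)]
    [MeasurableSpace Ω'] (Z : ∀ n, Ω n → T → ℝ) (P : ∀ n, Measure (Ω n))
    [∀ n, IsProbabilityMeasure (P n)] (ξ : Ω' → T → ℝ) (Q : Measure Ω')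
    [IsProbabilityMeasure Q] : Prop :=
  ∀ (k : ℕ) (t : Fin k → T),
    TendstoInDistribution (fun n (ω : Ω n) (j : Fin k) => Z n ω (t j)) atTop
      (fun ω j => ξ ω (t j)) P Q

/-- Weak convergence of processes on `C(T)`: all the processes have almost surely continuous paths,
and the random elements of `C(T, ℝ)` given by the paths converge in distribution. -/
def TendstoWeaklyOnC {T Ω' : Type*} [TopologicalSpace T] {Ω : ℕ → Type*}
    [∀ n, MeasurableSpace (Ω n)] [MeasurableSpace Ω'] (Z : ∀ n, Ω n → T → ℝ)
    (P : ∀ n, Measure (Ω n)) [∀ n, IsProbabilityMeasure (P n)] (ξ : Ω' → T → ℝ) (Q : Measure Ω')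
    [IsProbabilityMeasure Q] : Prop :=
  ∃ (Zc : ∀ n, Ω n → C(T, ℝ)) (ξc : Ω' → C(T, ℝ)),
    (∀ n, ∀ᵐ ω ∂(P n), ∀ t, Zc n ω t = Z n ω t) ∧
    (∀ᵐ ω ∂Q, ∀ t, ξc ω t = ξ ω t) ∧
    TendstoInDistribution Zc atTop ξc P Q

/-- The process `c_n(t) (max_{i ≤ n} η_i(t) - b_n(t))`, where `η_1, …, η_n` are `n` independent
copies of `η`, realized as the coordinates of the `n`-fold product of the probability space
on which `η` lives. -/
def normalizedMax {T Ω : Type*} (η : Ω → T → ℝ) (b c : ℕ → T → ℝ) (n : ℕ)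
    (ω : Fin n → Ω) (t : T) : ℝ :=
  c n t * ((⨆ i, η (ω i) t) - b n t)

/-- `η` is in the max-domain of attraction of `ξ`, in the sense of finite-dimensional
distributions. -/
def InMDAFinDim {T Ω Ω' : Type*} [MeasurableSpace Ω] [MeasurableSpace Ω']
    (η : Ω → T → ℝ) (P : Measure Ω) [IsProbabilityMeasure P]
    (ξ : Ω' → T → ℝ) (Q : Measure Ω') [IsProbabilityMeasure Q] : Prop :=
  ∃ b c : ℕ → T → ℝ, (∀ n t, 0 < c n t) ∧
    TendstoFinDim (normalizedMax η b c) (fun n => Measure.pi fun _ : Fin n => P) ξ Q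

/-- `η` is in the max-domain of attraction of `ξ`, in the sense of weak convergence on `C(T)`. -/
def InMDAWeaklyOnC {T Ω Ω' : Type*} [TopologicalSpace T] [MeasurableSpace Ω] [MeasurableSpace Ω']
    (η : Ω → T → ℝ) (P : Measure Ω) [IsProbabilityMeasure P]
    (ξ : Ω' → T → ℝ) (Q : Measure Ω') [IsProbabilityMeasure Q] : Prop :=
  ∃ b c : ℕ → T → ℝ, (∀ n t, 0 < c n t) ∧
    TendstoWeaklyOnC (normalizedMax η b c) (fun n => Measure.pi fun _ : Fin n => P) ξ Q

/-! ### Mixed moving maxima -/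

/-- Triples `(u, t, f)`; all intensities below are concentrated on `u > 0`. -/
abbrev Storm (d : ℕ) : Type :=
  ℝ × EuclideanSpace ℝ (Fin d) × C(EuclideanSpace ℝ (Fin d), ℝ≥0)

/-- The value `u f(s - t)` at `s` of the storm `(u, t, f)`. -/
def stormAt {d : ℕ} (x : Storm d) (s : EuclideanSpace ℝ (Fin d)) : ℝ :=
  x.1 * (x.2.2 (s - x.2.1) : ℝ)

/-- `s ↦ max_i U_i F_i(s - T_i)` for the points `X i = (U_i, T_i, F_i)`. -/
def stormMax {d : ℕ} {Ω : Type*} (X : ℕ → Ω → Storm d) (ω : Ω)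
    (s : EuclideanSpace ℝ (Fin d)) : ℝ :=
  ⨆ i, stormAt (X i ω) s

/-- The measure `u⁻² du` on `(0, ∞)`. -/
def frechetIntensity : Measure ℝ :=
  (volume.restrict (Ioi 0)).withDensity fun u => ENNReal.ofReal (u ^ 2)⁻¹

/-- The intensity `u⁻² du dt P_F(df)`. -/
def m3Intensity {d : ℕ} (PF : Measure C(EuclideanSpace ℝ (Fin d), ℝ≥0)) : Measure (Storm d) :=
  frechetIntensity.prod (volume.prod PF)

/-- The intensity `c 1{u ≥ ε} u⁻² du dt P_F(df)`. -/
def truncatedIntensity {d : ℕ} (c ε : ℝ) (PF : Measure C(EuclideanSpace ℝ (Fin d), ℝ≥0)) :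
    Measure (Storm d) :=
  (ENNReal.ofReal c • frechetIntensity.restrict (Ici ε)).prod (volume.prod PF)

/-- A random shape function: a random element `F` of the space of non-negative continuous functions
with `E ∫ F(t) dt = 1`. -/
def IsShapeFunction {d : ℕ} {S : Type*} [MeasurableSpace S] (ρ : Measure S)
    (F : S → C(EuclideanSpace ℝ (Fin d), ℝ≥0)) : Prop :=
  Measurable F ∧ (∫⁻ σ, (∫⁻ t, (F σ t : ℝ≥0∞)) ∂ρ) = 1

/-- `∫ E (max_{t₀ ∈ K} F(t₀ - t)) dt < ∞` for all compact sets `K`. -/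
def SupIntegrable {d : ℕ} {S : Type*} [MeasurableSpace S] (ρ : Measure S)
    (F : S → C(EuclideanSpace ℝ (Fin d), ℝ≥0)) : Prop :=
  ∀ K : Set (EuclideanSpace ℝ (Fin d)), IsCompact K →
    ∫⁻ t, (∫⁻ σ, ⨆ t₀ ∈ K, (F σ (t₀ - t) : ℝ≥0∞) ∂ρ) < ∞

end

/-! ### The Borel sigma-algebra of a space of continuous functions -/

/-! The norming is `b_n = 0`, `c_n = 1/(cn)`. The union of `n` independent copies of the truncated
process has intensity `cn 1{u ≥ ε} u⁻² du dt P_F(df)`, and dividing `u` by `cn` turns this into `1{u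
≥ ε/(cn)} u⁻² du dt P_F(df)`. So the normalized maximum has the law of a functional of `Π₀` itself:
discard the storms with `u < ε/(cn)` and take the maximum with `κ/(cn)`. All these functionals
(`cutStormMax`) live on one probability space, where they converge almost surely to `M`; no
tightness argument is needed.

Equality of laws (`map_normalizedMax_eq_map_cutStormMax`) is checked on distribution functions,
which are void probabilities, and the exponents agree by `m3Intensity_scaling`. Almost sure
convergence (`tendstoUniformlyOn_cutStormMax`) rests on `FewAboveOn`: the mean number of storms
exceeding `η` somewhere on `K` is at most `η⁻¹ ∫ E sup_K F(· - t) dt`. For a single site this is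
`1/η`; for compact `K` it is finite under the hypothesis of part 2. The weak statement also uses
that a law on `C(T, ℝ)` is determined by its finite-dimensional distributions. -/

theorem measurableSet_comap_mapsTo {T : Type*} [TopologicalSpace T] [SecondCountableTopology T]
    {K : Set T} (hK : IsCompact K) {U : Set ℝ} (hU : IsOpen U) :
    MeasurableSet[MeasurableSpace.comap (fun f : C(T, ℝ) => (f : T → ℝ)) MeasurableSpace.pi]
      {f : C(T, ℝ) | MapsTo f K U} := by
  obtain ⟨D, hDc, hDd⟩ := TopologicalSpace.exists_countable_dense K
  -- By compactness `f(K) ⊆ U` keeps a distance at least `1/m` from `Uᶜ`, and by continuity this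
  -- need only be tested on the countable dense set `D`. The extended distance is infinite when `Uᶜ`
  -- is empty, as required.
  have key : {f : C(T, ℝ) | MapsTo f K U} = (fun f : C(T, ℝ) => (f : T → ℝ)) ⁻¹'
      ⋃ m : ℕ, ⋂ x ∈ D, {g : T → ℝ | ((m : ℝ≥0∞))⁻¹ ≤ Metric.infEDist (g x) Uᶜ} := by
    ext f
    simp only [mem_ofPred_eq, mem_preimage, mem_iUnion, mem_iInter]
    have hcont : Continuous fun x : T => Metric.infEDist (f x) Uᶜ :=
      Metric.continuous_infEDist.comp f.continuous
    constructor
    · intro h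
      rcases K.eq_empty_or_nonempty with rfl | hne
      · exact ⟨0, fun x => absurd x.2 (notMem_empty _)⟩
      · obtain ⟨x₀, hx₀, hmin⟩ := hK.exists_isMinOn hne hcont.continuousOn
        have hpos : Metric.infEDist (f x₀) Uᶜ ≠ 0 := by
          rw [Ne, ← Metric.mem_closure_iff_infEDist_zero, hU.isClosed_compl.closure_eq]
          exact fun h' => h' (h hx₀)
        obtain ⟨m, hm⟩ := ENNReal.exists_inv_nat_lt hpos
        exact ⟨m, fun x _ => hm.le.trans (hmin x.2)⟩
    · rintro ⟨m, hm⟩ x hx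
      have hcl : IsClosed {y : K | ((m : ℝ≥0∞))⁻¹ ≤ Metric.infEDist (f y) Uᶜ} :=
        isClosed_le continuous_const (hcont.comp continuous_subtype_val)
      have hx' : (⟨x, hx⟩ : K) ∈ {y : K | ((m : ℝ≥0∞))⁻¹ ≤ Metric.infEDist (f y) Uᶜ} :=
        hcl.closure_subset_iff.2 (fun y hy => hm y hy) (hDd _)
      by_contra hxU
      have h0 : Metric.infEDist (f x) Uᶜ = 0 := Metric.infEDist_zero_of_mem hxU
      rw [mem_ofPred_eq] at hx'
      simp [h0] at hx'
  rw [key]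
  refine ⟨_, MeasurableSet.iUnion fun m => MeasurableSet.biInter hDc fun x _ => ?_, rfl⟩
  exact measurableSet_le measurable_const
    (Metric.continuous_infEDist.measurable.comp (measurable_pi_apply _))

/-- `C(T, ℝ)` is second countable here, so its Borel sets are generated by the compact-open
subbasis. -/
theorem continuousMap_measurableSpace_eq_comap {T : Type*} [TopologicalSpace T]
    [SecondCountableTopology T] [LocallyCompactSpace T] :
    (continuousMapMeasurableSpace : MeasurableSpace C(T, ℝ)) =
      MeasurableSpace.comap (fun f : C(T, ℝ) => (f : T → ℝ)) MeasurableSpace.pi := by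
  apply le_antisymm
  · change borel _ ≤ _
    rw [borel_eq_generateFrom_of_subbasis ContinuousMap.compactOpen_eq]
    refine MeasurableSpace.generateFrom_le ?_
    rintro _ ⟨K, hK, U, hU, rfl⟩
    exact measurableSet_comap_mapsTo hK hU
  · rw [← measurable_iff_comap_le]
    exact measurable_pi_lambda _ fun t => (continuous_eval_const t).measurable

theorem measurable_continuousMap_of_eval {T A : Type*} [TopologicalSpace T]
    [SecondCountableTopology T] [LocallyCompactSpace T] [MeasurableSpace A] {Z : A → C(T, ℝ)}
    (hZ : ∀ t, Measurable fun a => Z a t) : Measurable Z := by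
  rw [measurable_iff_comap_le, continuousMap_measurableSpace_eq_comap,
    MeasurableSpace.comap_comp, ← measurable_iff_comap_le]
  exact measurable_pi_lambda _ hZ

theorem measurable_continuousMap_coe {T : Type*} [TopologicalSpace T] :
    Measurable fun f : C(T, ℝ) => (f : T → ℝ) :=
  measurable_pi_lambda _ fun t => (continuous_eval_const t).measurable

/-- A finite measure on `C(T, ℝ)` is determined by its finite-dimensional distributions. -/
theorem continuousMap_measure_ext {T : Type*} [TopologicalSpace T]
    [SecondCountableTopology T] [LocallyCompactSpace T] {μ ν : Measure C(T, ℝ)}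
    [IsFiniteMeasure μ]
    (h : ∀ I : Finset T, μ.map (fun f (t : I) => f t) = ν.map (fun f (t : I) => f t)) :
    μ = ν := by
  have hmap : μ.map (fun f : C(T, ℝ) => (f : T → ℝ)) =
      ν.map (fun f : C(T, ℝ) => (f : T → ℝ)) := by
    have aux (m : Measure C(T, ℝ)) : IsProjectiveLimit (m.map (fun f : C(T, ℝ) => (f : T → ℝ)))
        (fun I => m.map (fun f (t : I) => f t)) := fun I => by
      rw [Measure.map_map (Finset.measurable_restrict I) measurable_continuousMap_coe]
      rfl
    have hν := aux ν
    simp_rw [← h] at hν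
    have : ∀ I : Finset T, IsFiniteMeasure (μ.map (fun f (t : I) => f t)) := fun I =>
      inferInstance
    exact (aux μ).unique hν
  ext s hs
  rw [continuousMap_measurableSpace_eq_comap] at hs
  obtain ⟨s', hs', rfl⟩ := hs
  rw [← Measure.map_apply measurable_continuousMap_coe hs', hmap,
    Measure.map_apply measurable_continuousMap_coe hs']

/-- A finite measure on `ℝ^ι` is determined by its distribution function. -/
theorem measure_ext_of_Iic_box {ι : Type*} [Finite ι] {μ ν : Measure (ι → ℝ)}
    [IsProbabilityMeasure μ] [IsProbabilityMeasure ν]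
    (h : ∀ z : ι → ℝ, μ {x | ∀ j, x j ≤ z j} = ν {x | ∀ j, x j ≤ z j}) : μ = ν := by
  have hspan : IsCountablySpanning (range Iic : Set (Set ℝ)) :=
    ⟨fun n : ℕ => Iic (n : ℝ), fun n => ⟨_, rfl⟩, by
      rw [iUnion_eq_univ_iff]; exact fun x => exists_nat_ge x⟩
  have hgen : MeasurableSpace.generateFrom (range Iic : Set (Set ℝ)) = Real.measurableSpace := by
    rw [← borel_eq_generateFrom_Iic, (inferInstance : BorelSpace ℝ).measurable_eq]
  refine ext_of_generate_finite _ (generateFrom_eq_pi (fun _ : ι => hgen) fun _ => hspan).symm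
    (IsPiSystem.pi fun _ => isPiSystem_Iic) ?_ (by simp)
  rintro _ ⟨s, hs, rfl⟩
  choose z hz using fun j => hs j (mem_univ j)
  have : Set.pi univ s = {x | ∀ j, x j ≤ z j} := by
    ext x
    simp [← hz]
  rw [this, h]

/-! ### Suprema of families with few large members on compact sets -/

/-- Above each positive level, only finitely many of the functions `g i` show up on `K`. -/
def FewAboveOn {ι α : Type*} (g : ι → α → ℝ) (K : Set α) : Prop :=
  ∀ η : ℝ, 0 < η → {i | ∃ s ∈ K, η < g i s}.Finite

/-- Only positive levels matter, so a bound by `max 0 (g i s)` suffices; this covers storms replaced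
by `0`. -/
theorem FewAboveOn.mono {ι α : Type*} {g g' : ι → α → ℝ} {K K' : Set α} (h : FewAboveOn g K)
    (hK : K' ⊆ K) (hg : ∀ i s, g' i s ≤ max 0 (g i s)) : FewAboveOn g' K' := fun η hη =>
  (h η hη).subset fun i ⟨s, hs, hi⟩ => ⟨s, hK hs, by
    rcases lt_max_iff.1 (hi.trans_le (hg i s)) with h | h
    · exact absurd h hη.not_gt
    · exact h⟩

theorem FewAboveOn.bddAbove {ι α : Type*} {g : ι → α → ℝ} {K : Set α} (h : FewAboveOn g K)
    {s : α} (hs : s ∈ K) : BddAbove (range fun i => g i s) := by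
  have hfin := ((h 1 one_pos).image fun i => g i s).bddAbove
  refine (hfin.union (bddAbove_Iic (a := (1 : ℝ)))).mono ?_
  rintro _ ⟨i, rfl⟩
  by_cases hi : 1 < g i s
  · exact Or.inl ⟨i, ⟨s, hs, hi⟩, rfl⟩
  · exact Or.inr (not_lt.1 hi)

/-- Any supremum of continuous functions is lower semicontinuous. For the upper bound, take `η`
strictly between the supremum at `s₀` and `b`: the finitely many members exceeding `η` on `K` are
below `η` near `s₀`, and the others never exceed it on `K`. -/
theorem continuous_iSup_of_fewAboveOn {ι α : Type*} [Nonempty ι] [TopologicalSpace α]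
    [WeaklyLocallyCompactSpace α] {g : ι → α → ℝ} (hg : ∀ i, Continuous (g i))
    (hg0 : ∀ i s, 0 ≤ g i s) (h : ∀ K, IsCompact K → FewAboveOn g K) :
    Continuous fun s => ⨆ i, g i s := by
  have hb : ∀ s, BddAbove (range fun i => g i s) := fun s =>
    (h {s} isCompact_singleton).bddAbove rfl
  rw [continuous_iff_continuousAt]
  intro s₀
  obtain ⟨K, hK, hKs⟩ := exists_compact_mem_nhds s₀
  refine tendsto_order.2 ⟨fun a ha => ?_, fun b hb' => ?_⟩
  · obtain ⟨i, hi⟩ := exists_lt_of_lt_ciSup ha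
    filter_upwards [(hg i).continuousAt.eventually (lt_mem_nhds hi)] with s hs
    exact lt_of_lt_of_le hs (le_ciSup (hb s) i)
  · obtain ⟨η, hη, hηb⟩ := exists_between hb'
    have hη0 : 0 < η :=
      lt_of_le_of_lt ((hg0 (Classical.arbitrary ι) s₀).trans (le_ciSup (hb s₀) _)) hη
    have hev : ∀ᶠ s in 𝓝 s₀, ∀ i ∈ {i | ∃ s ∈ K, η < g i s}, g i s < η :=
      (eventually_all_finite (h K hK η hη0)).2 fun i _ =>
        (hg i).continuousAt.eventually (gt_mem_nhds ((le_ciSup (hb s₀) i).trans_lt hη))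
    filter_upwards [hev, hKs] with s hs hsK
    refine lt_of_le_of_lt (ciSup_le fun i => ?_) hηb
    by_contra hi
    exact hi (hs i ⟨s, hsK, not_le.1 hi⟩).le

/-! ### Suprema of storms above a threshold -/

/-- `κ ∨ max_i u_i f_i(s - t_i)`, where only the storms with `u_i ≥ δ` are kept. -/
noncomputable def cutStormMax {d : ℕ} (δ κ : ℝ) (x : ℕ → Storm d)
    (s : EuclideanSpace ℝ (Fin d)) : ℝ :=
  max κ (⨆ i, if δ ≤ (x i).1 then stormAt (x i) s else 0)

theorem stormAt_nonneg {d : ℕ} {x : Storm d} (hx : 0 < x.1) (s : EuclideanSpace ℝ (Fin d)) :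
    0 ≤ stormAt x s :=
  mul_nonneg hx.le (NNReal.coe_nonneg _)

theorem continuous_stormAt_left {d : ℕ} (s : EuclideanSpace ℝ (Fin d)) :
    Continuous fun x : Storm d => stormAt x s := by
  unfold stormAt
  fun_prop

theorem continuous_stormAt_right {d : ℕ} (x : Storm d) : Continuous (stormAt x) := by
  unfold stormAt
  fun_prop

theorem measurable_stormAt {d : ℕ} (s : EuclideanSpace ℝ (Fin d)) :
    Measurable fun x : Storm d => stormAt x s :=
  (continuous_stormAt_left s).measurable

theorem fewAboveOn_cut {d : ℕ} (δ : ℝ) {x : ℕ → Storm d} {K : Set (EuclideanSpace ℝ (Fin d))}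
    (h : FewAboveOn (fun i => stormAt (x i)) K) :
    FewAboveOn (fun i s => if δ ≤ (x i).1 then stormAt (x i) s else 0) K :=
  h.mono subset_rfl fun i s => by
    split_ifs
    · exact le_max_right _ _
    · exact le_max_left _ _

theorem continuous_iSup_stormAt {d : ℕ} {x : ℕ → Storm d} (hx : ∀ i, 0 < (x i).1)
    (h : ∀ K, IsCompact K → FewAboveOn (fun i => stormAt (x i)) K) :
    Continuous fun s => ⨆ i, stormAt (x i) s :=
  continuous_iSup_of_fewAboveOn (fun i => continuous_stormAt_right (x i))
    (fun i => stormAt_nonneg (hx i)) h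

theorem continuous_cutStormMax {d : ℕ} (δ κ : ℝ) {x : ℕ → Storm d} (hx : ∀ i, 0 < (x i).1)
    (h : ∀ K, IsCompact K → FewAboveOn (fun i => stormAt (x i)) K) :
    Continuous (cutStormMax δ κ x) := by
  refine continuous_const.max (continuous_iSup_of_fewAboveOn (fun i => ?_) (fun i s => ?_)
    fun K hK => fewAboveOn_cut δ (h K hK))
  · split_ifs
    · exact continuous_stormAt_right (x i)
    · exact continuous_const
  · split_ifs
    · exact stormAt_nonneg (hx i) s
    · exact le_rfl

/-- This makes the distribution function a void event. Discarded storms contribute `0 < κ`, hence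
impose no condition. -/
theorem cutStormMax_le_iff {d : ℕ} {δ κ : ℝ} (hκ : 0 < κ) {x : ℕ → Storm d}
    {s : EuclideanSpace ℝ (Fin d)} (h : BddAbove (range fun i => stormAt (x i) s)) {z : ℝ} :
    cutStormMax δ κ x s ≤ z ↔ κ ≤ z ∧ ∀ i, ¬ (δ ≤ (x i).1 ∧ z < stormAt (x i) s) := by
  have hb : BddAbove (range fun i => if δ ≤ (x i).1 then stormAt (x i) s else 0) := by
    obtain ⟨b, hb⟩ := h
    refine ⟨max 0 b, ?_⟩
    rintro _ ⟨i, rfl⟩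
    dsimp only
    split_ifs
    · exact (hb ⟨i, rfl⟩).trans (le_max_right _ _)
    · exact le_max_left _ _
  rw [cutStormMax, max_le_iff, ciSup_le_iff hb]
  refine and_congr_right fun hz => forall_congr' fun i => ?_
  split_ifs with hi
  · simp [hi]
  · simp [hi, (hκ.trans_le hz).le]

/-- Only finitely many storms exceed `e / 2` on `K`, each with positive `u`. Once `δ n` is below all
of these, the cut removes only storms of height at most `e / 2` on `K`. -/
theorem tendstoUniformlyOn_cutStormMax {d : ℕ} {x : ℕ → Storm d} (hx : ∀ i, 0 < (x i).1)
    {K : Set (EuclideanSpace ℝ (Fin d))} (h : FewAboveOn (fun i => stormAt (x i)) K)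
    {δ κ : ℕ → ℝ} (hδ : Tendsto δ atTop (𝓝 0)) (hκ : Tendsto κ atTop (𝓝 0))
    (hκ0 : ∀ n, 0 ≤ κ n) :
    TendstoUniformlyOn (fun n => cutStormMax (δ n) (κ n) x) (fun s => ⨆ i, stormAt (x i) s)
      atTop K := by
  rw [Metric.tendstoUniformlyOn_iff]
  intro e he
  have hI := h (e / 2) (half_pos he)
  have hev : ∀ᶠ n in atTop, ∀ i ∈ {i | ∃ s ∈ K, e / 2 < stormAt (x i) s}, δ n < (x i).1 :=
    (eventually_all_finite hI).2 fun i _ => hδ.eventually (gt_mem_nhds (hx i))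
  filter_upwards [hev, hκ.eventually (gt_mem_nhds (half_pos he))] with n hn hκn s hs
  have hb := h.bddAbove hs
  have hb' := (fewAboveOn_cut (δ n) h).bddAbove hs
  have h0 : 0 ≤ ⨆ i, stormAt (x i) s := (stormAt_nonneg (hx 0) s).trans (le_ciSup hb 0)
  have hle : cutStormMax (δ n) (κ n) x s ≤ (⨆ i, stormAt (x i) s) + e / 2 := by
    refine max_le (by linarith) (ciSup_le fun i => ?_)
    split_ifs
    · linarith [le_ciSup hb i]
    · linarith
  have hge : (⨆ i, stormAt (x i) s) ≤ cutStormMax (δ n) (κ n) x s + e / 2 := by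
    refine ciSup_le fun i => ?_
    have hκle : κ n ≤ cutStormMax (δ n) (κ n) x s := le_max_left _ _
    by_cases hi : e / 2 < stormAt (x i) s
    · have h1 := le_ciSup hb' i
      rw [if_pos (hn i ⟨s, hs, hi⟩).le] at h1
      have h2 := h1.trans (le_max_right (κ n) _)
      change _ ≤ cutStormMax (δ n) (κ n) x s at h2
      linarith
    · linarith [hκ0 n, not_lt.1 hi]
  rw [Real.dist_eq, abs_lt]
  constructor <;> linarith [half_lt_self he]

theorem measurable_cutStormMax {d : ℕ} {Ω : Type*} [MeasurableSpace Ω] {X : ℕ → Ω → Storm d}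
    (hX : ∀ i, Measurable (X i)) (δ κ : ℝ) (s : EuclideanSpace ℝ (Fin d)) :
    Measurable fun ω => cutStormMax δ κ (fun i => X i ω) s := by
  refine measurable_const.max (Measurable.iSup fun i => Measurable.ite ?_ ?_ measurable_const)
  · exact measurableSet_le measurable_const (measurable_fst.comp (hX i))
  · exact (measurable_stormAt s).comp (hX i)

theorem measurable_stormMax {d : ℕ} {Ω : Type*} [MeasurableSpace Ω] {X : ℕ → Ω → Storm d}
    (hX : ∀ i, Measurable (X i)) (s : EuclideanSpace ℝ (Fin d)) :
    Measurable fun ω => stormMax X ω s :=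
  Measurable.iSup fun i => (measurable_stormAt s).comp (hX i)

/-! ### Poisson point processes -/

theorem countingMeasure_apply {Ω E : Type*} [MeasurableSpace E] (X : ℕ → Ω → E) (ω : Ω)
    {B : Set E} (hB : MeasurableSet B) :
    countingMeasure X ω B = ∑' i, B.indicator 1 (X i ω) := by
  simp_rw [countingMeasure, Measure.sum_apply _ hB, Measure.dirac_apply' _ hB]

theorem measurable_countingMeasure_apply {Ω E : Type*} [MeasurableSpace Ω] [MeasurableSpace E]
    {X : ℕ → Ω → E} (hX : ∀ i, Measurable (X i)) {B : Set E} (hB : MeasurableSet B) :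
    Measurable fun ω => countingMeasure X ω B := by
  simp_rw [countingMeasure_apply X _ hB]
  exact Measurable.tsum fun i => (measurable_one.indicator hB).comp (hX i)

namespace IsPoissonPointProcess

variable {Ω E : Type*} [MeasurableSpace Ω] [MeasurableSpace E] {P : Measure Ω} {μ : Measure E}
  {X : ℕ → Ω → E}

theorem measure_forall_notMem (h : IsPoissonPointProcess P μ X) {B : Set E}
    (hB : MeasurableSet B) (hμ : μ B ≠ ∞) :
    P {ω | ∀ i, X i ω ∉ B} = ENNReal.ofReal (Real.exp (-(μ B).toReal)) := by
  have h0 : {ω | ∀ i, X i ω ∉ B} = (fun ω => countingMeasure X ω B) ⁻¹' {0} := by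
    ext ω
    simp [countingMeasure_apply X ω hB]
  have h1 : (fun k : ℕ => (k : ℝ≥0∞)) ⁻¹' {0} = {0} := by
    ext k
    simp
  rw [h0, ← Measure.map_apply (measurable_countingMeasure_apply h.measurable_point hB)
    (measurableSet_singleton _), h.law_count B hB hμ,
    Measure.map_apply (measurable_of_countable _) (measurableSet_singleton _), h1,
    poissonMeasure_singleton]
  simp [ENNReal.coe_toNNReal_eq_toReal]

theorem ae_finite (h : IsPoissonPointProcess P μ X) {B : Set E}
    (hB : MeasurableSet B) (hμ : μ B ≠ ∞) : ∀ᵐ ω ∂P, {i | X i ω ∈ B}.Finite := by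
  have h1 : (fun k : ℕ => (k : ℝ≥0∞)) ⁻¹' {∞} = ∅ := by
    ext k
    simp
  have h0 : P ((fun ω => countingMeasure X ω B) ⁻¹' {∞}) = 0 := by
    rw [← Measure.map_apply (measurable_countingMeasure_apply h.measurable_point hB)
      (measurableSet_singleton _), h.law_count B hB hμ,
      Measure.map_apply (measurable_of_countable _) (measurableSet_singleton _), h1, measure_empty]
  have h2 : ∀ᵐ ω ∂P, countingMeasure X ω B ≠ ∞ := by
    rw [ae_iff]
    simpa [preimage] using h0
  filter_upwards [h2] with ω hω
  rw [countingMeasure_apply X ω hB] at hω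
  refine (ENNReal.finite_const_le_of_tsum_ne_top hω one_ne_zero).subset fun i hi => ?_
  rw [mem_ofPred_eq] at hi ⊢
  rw [indicator_of_mem hi, Pi.one_apply]

theorem ae_forall_notMem [IsProbabilityMeasure P] (h : IsPoissonPointProcess P μ X) {B : Set E}
    (hB : MeasurableSet B) (hμ : μ B = 0) : ∀ᵐ ω ∂P, ∀ i, X i ω ∉ B := by
  have hm : MeasurableSet {ω | ∀ i, X i ω ∉ B} := by
    simp only [ofPred_forall]
    exact MeasurableSet.iInter fun i => h.measurable_point i hB.compl
  have h1 := h.measure_forall_notMem hB (hμ ▸ ENNReal.zero_ne_top)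
  rw [hμ] at h1
  have h2 : P {ω | ∀ i, X i ω ∉ B} = 1 := by simpa using h1
  exact (mem_ae_iff_prob_eq_one hm).2 h2

end IsPoissonPointProcess

/-! ### The intensity measures -/

instance : SFinite frechetIntensity := by
  unfold frechetIntensity
  infer_instance

theorem frechetIntensity_apply {s : Set ℝ} (hs : MeasurableSet s) :
    frechetIntensity s =
      ∫⁻ u, s.indicator 1 u * (Ioi 0).indicator (fun u => ENNReal.ofReal (u ^ 2)⁻¹) u := by
  rw [frechetIntensity, withDensity_apply _ hs, ← lintegral_indicator hs,
    ← lintegral_indicator measurableSet_Ioi]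
  refine lintegral_congr fun u => ?_
  by_cases h1 : u ∈ s <;> by_cases h2 : u ∈ Ioi (0 : ℝ) <;> simp [h1, h2]

theorem frechetIntensity_Iic_zero : frechetIntensity (Iic 0) = 0 := by
  refine withDensity_absolutelyContinuous _ _ ?_
  rw [Measure.restrict_apply measurableSet_Iic, Iic_inter_Ioi, Ioc_self, measure_empty]

theorem frechetIntensity_Ioi {b : ℝ} (hb : 0 < b) :
    frechetIntensity (Ioi b) = ENNReal.ofReal b⁻¹ := by
  have hfun : ∀ u ∈ Ioi b, (u ^ 2)⁻¹ = u ^ (-2 : ℝ) := fun u hu => by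
    rw [Real.rpow_neg (hb.trans hu).le, Real.rpow_two]
  have hint : IntegrableOn (fun u : ℝ => (u ^ 2)⁻¹) (Ioi b) :=
    (integrableOn_Ioi_rpow_of_lt (by norm_num : (-2 : ℝ) < -1) hb).congr_fun
      (fun u hu => (hfun u hu).symm) measurableSet_Ioi
  rw [frechetIntensity, withDensity_apply _ measurableSet_Ioi,
    Measure.restrict_restrict measurableSet_Ioi,
    inter_eq_left.2 (Ioi_subset_Ioi hb.le),
    ← ofReal_integral_eq_lintegral_ofReal hint (ae_of_all _ fun u => by positivity),
    setIntegral_congr_fun measurableSet_Ioi hfun, integral_Ioi_rpow_of_lt (by norm_num) hb]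
  congr 1
  norm_num
  rw [Real.rpow_neg_one]

/-- Homogeneity of `u⁻² du`; it is what dictates the norming `1/(cn)`. -/
theorem map_mul_left_frechetIntensity {r : ℝ} (hr : 0 < r) :
    frechetIntensity.map (fun u => r * u) = ENNReal.ofReal r • frechetIntensity := by
  have hm : Measurable fun u : ℝ => r * u := measurable_const_mul r
  have hv (g : ℝ → ℝ≥0∞) (hg : Measurable g) :
      ∫⁻ u, g u = ENNReal.ofReal r * ∫⁻ u, g (r * u) := by
    conv_lhs => rw [← Real.smul_map_volume_mul_left hr.ne', lintegral_smul_measure,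
      lintegral_map hg hm, abs_of_pos hr, smul_eq_mul]
  have hg : Measurable ((Ioi (0 : ℝ)).indicator fun u => ENNReal.ofReal (u ^ 2)⁻¹) :=
    Measurable.indicator (by fun_prop) measurableSet_Ioi
  ext s hs
  have hgs : Measurable fun u : ℝ => s.indicator (1 : ℝ → ℝ≥0∞) u *
      (Ioi (0 : ℝ)).indicator (fun u => ENNReal.ofReal (u ^ 2)⁻¹) u :=
    (measurable_one.indicator hs).mul hg
  have hgs' : Measurable fun u : ℝ => s.indicator (1 : ℝ → ℝ≥0∞) (r * u) *
      (Ioi (0 : ℝ)).indicator (fun u => ENNReal.ofReal (u ^ 2)⁻¹) (r * u) := hgs.comp hm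
  rw [Measure.map_apply hm hs, frechetIntensity_apply (hm hs), Measure.smul_apply,
    frechetIntensity_apply hs, hv _ hgs, smul_eq_mul, ← mul_assoc,
    ← lintegral_const_mul _ hgs']
  refine lintegral_congr fun u => ?_
  by_cases hu : 0 < u
  · have hru : 0 < r * u := mul_pos hr hu
    -- One factor `r` is the Jacobian, the other the scalar in the claim.
    have : ENNReal.ofReal (u ^ 2)⁻¹ =
        ENNReal.ofReal r * ENNReal.ofReal r * ENNReal.ofReal ((r * u) ^ 2)⁻¹ := by
      rw [← ENNReal.ofReal_mul hr.le, ← ENNReal.ofReal_mul (by positivity)]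
      congr 1
      field_simp
    rw [indicator_of_mem (mem_Ioi.2 hu), indicator_of_mem (mem_Ioi.2 hru), this]
    by_cases h : r * u ∈ s
    · rw [indicator_of_mem h, indicator_of_mem (mem_preimage.2 h)]
      simp
    · rw [indicator_of_notMem h, indicator_of_notMem (fun h' => h (mem_preimage.1 h'))]
      simp
  · have hru : ¬ 0 < r * u := fun h => hu (pos_of_mul_pos_right h hr.le)
    rw [indicator_of_notMem (fun h => hu (mem_Ioi.1 h)),
      indicator_of_notMem (fun h => hru (mem_Ioi.1 h))]
    simp

/-- For `0 < a < ∞` this is the tail mass of `(η / a, ∞)`. The value `a = ∞` is admitted because `a`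
will be a supremum of a shape over an arbitrary set. -/
theorem frechetIntensity_mul_gt_le {η : ℝ} (hη : 0 < η) (a : ℝ≥0∞) :
    frechetIntensity {u | ENNReal.ofReal η < ENNReal.ofReal u * a} ≤
      (ENNReal.ofReal η)⁻¹ * a := by
  have hη' : ENNReal.ofReal η ≠ 0 := by simpa using hη
  rcases eq_or_ne a 0 with rfl | ha0
  · simp
  rcases eq_or_ne a ∞ with rfl | ha
  · rw [ENNReal.mul_top (by simp)]
    exact le_top
  · lift a to ℝ≥0 using ha
    have ha' : (0 : ℝ) < a := by
      have : a ≠ 0 := by simpa using ha0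
      exact_mod_cast pos_iff_ne_zero.2 this
    have hsub : {u | ENNReal.ofReal η < ENNReal.ofReal u * a} ⊆ Ioi (η / a) := by
      intro u hu
      rw [mem_ofPred_eq, ← ENNReal.ofReal_coe_nnreal, ← ENNReal.ofReal_mul' ha'.le,
        ENNReal.ofReal_lt_ofReal_iff_of_nonneg hη.le] at hu
      exact (div_lt_iff₀ ha').2 hu
    refine (measure_mono hsub).trans ?_
    rw [frechetIntensity_Ioi (div_pos hη ha'), inv_div, ENNReal.ofReal_div_of_pos hη,
      ENNReal.ofReal_coe_nnreal, ENNReal.div_eq_inv_mul]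

section Intensity

variable {d : ℕ}

local notation:max "𝔼" d:max => EuclideanSpace ℝ (Fin d)

/-- The union over `K` may be uncountable, but it is a union of open sets. -/
theorem measurableSet_storm_exceeds (K : Set 𝔼 d) (η : ℝ) :
    MeasurableSet {x : Storm d | ∃ s ∈ K, η < stormAt x s} := by
  have : {x : Storm d | ∃ s ∈ K, η < stormAt x s} = ⋃ s ∈ K, {x | η < stormAt x s} := by
    ext; simp
  rw [this]
  exact (isOpen_biUnion fun s _ =>
    isOpen_lt continuous_const (continuous_stormAt_left s)).measurableSet

theorem measurableSet_exists_lt_stormAt {ι : Type*} (t : ι → 𝔼 d) (z : ι → ℝ) :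
    MeasurableSet {x : Storm d | ∃ j, z j < stormAt x (t j)} := by
  simp only [ofPred_exists]
  exact (isOpen_iUnion fun j =>
    isOpen_lt continuous_const (continuous_stormAt_left (t j))).measurableSet

theorem measurable_iSup_shape (K : Set 𝔼 d) :
    Measurable fun y : 𝔼 d × C(𝔼 d, ℝ≥0) => ⨆ s ∈ K, (y.2 (s - y.1) : ℝ≥0∞) := by
  refine LowerSemicontinuous.measurable (lowerSemicontinuous_biSup fun s _ =>
    Continuous.lowerSemicontinuous ?_)
  fun_prop

/-- A first-moment bound, obtained by integrating out `u` for fixed `(t, f)`. -/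
theorem m3Intensity_exceeds_ne_top {PF : Measure C(𝔼 d, ℝ≥0)} [SFinite PF] {K : Set 𝔼 d}
    (hK : ∫⁻ t, (∫⁻ f, ⨆ s ∈ K, (f (s - t) : ℝ≥0∞) ∂PF) < ∞) {η : ℝ} (hη : 0 < η) :
    m3Intensity PF {x | ∃ s ∈ K, η < stormAt x s} ≠ ∞ := by
  refine ne_of_lt ?_
  rw [m3Intensity, Measure.prod_apply_symm (measurableSet_storm_exceeds K η)]
  calc ∫⁻ y, frechetIntensity ((fun u => (u, y)) ⁻¹' {x : Storm d | ∃ s ∈ K, η < stormAt x s})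
        ∂(volume.prod PF)
      ≤ ∫⁻ y : 𝔼 d × C(𝔼 d, ℝ≥0), (ENNReal.ofReal η)⁻¹ * ⨆ s ∈ K, (y.2 (s - y.1) : ℝ≥0∞)
        ∂(volume.prod PF) := by
        refine lintegral_mono fun y => (measure_mono ?_).trans (frechetIntensity_mul_gt_le hη _)
        rintro u ⟨s, hs, hu⟩
        rw [mem_ofPred_eq]
        calc ENNReal.ofReal η < ENNReal.ofReal (u * (y.2 (s - y.1) : ℝ)) :=
              (ENNReal.ofReal_lt_ofReal_iff_of_nonneg hη.le).2 hu
          _ = ENNReal.ofReal u * (y.2 (s - y.1) : ℝ≥0∞) := by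
              rw [ENNReal.ofReal_mul' (NNReal.coe_nonneg _), ENNReal.ofReal_coe_nnreal]
          _ ≤ _ := by
              gcongr
              exact le_iSup₂ (f := fun s _ => (y.2 (s - y.1) : ℝ≥0∞)) s hs
    _ < ∞ := by
        rw [lintegral_const_mul _ (measurable_iSup_shape K),
          lintegral_prod _ (measurable_iSup_shape K).aemeasurable]
        exact ENNReal.mul_lt_top (ENNReal.inv_lt_top.2 (by simpa using hη)) hK

theorem truncatedIntensity_le (c ε : ℝ) (PF : Measure C(𝔼 d, ℝ≥0)) [SFinite PF] :
    truncatedIntensity c ε PF ≤ ENNReal.ofReal c • m3Intensity PF := by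
  rw [truncatedIntensity, m3Intensity, ← Measure.prod_smul_left]
  exact Measure.prod_mono (by gcongr; exact Measure.restrict_le_self) le_rfl

theorem m3Intensity_nonpos (PF : Measure C(𝔼 d, ℝ≥0)) [SFinite PF] :
    m3Intensity PF {x | x.1 ≤ 0} = 0 := by
  have : {x : Storm d | x.1 ≤ 0} = Iic 0 ×ˢ univ := by ext; simp
  rw [this, m3Intensity, Measure.prod_prod, frechetIntensity_Iic_zero, zero_mul]

theorem truncatedIntensity_lt (c ε : ℝ) (PF : Measure C(𝔼 d, ℝ≥0)) [SFinite PF] :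
    truncatedIntensity c ε PF {x | x.1 < ε} = 0 := by
  have : {x : Storm d | x.1 < ε} = Iio ε ×ˢ univ := by ext; simp
  rw [this, truncatedIntensity, Measure.prod_prod, Measure.smul_apply,
    Measure.restrict_apply measurableSet_Iio, Iio_inter_Ici, Ico_self]
  simp

/-- Scaling: `n` times the truncated intensity is the image of `m3Intensity`, cut at the level
`ε / (c n)`, under multiplication of the first component by `c n`. -/
theorem m3Intensity_scaling {c ε : ℝ} (hc : 0 < c) {n : ℕ} (hn : n ≠ 0)
    (PF : Measure C(𝔼 d, ℝ≥0)) [SFinite PF] {ι : Type*} (t : ι → 𝔼 d) (z : ι → ℝ) :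
    m3Intensity PF {x | ε / (c * n) ≤ x.1 ∧ ∃ j, z j < stormAt x (t j)} =
      n * truncatedIntensity c ε PF {x | ∃ j, c * n * z j < stormAt x (t j)} := by
  have hr : 0 < c * n := mul_pos hc (by exact_mod_cast Nat.pos_of_ne_zero hn)
  have hB := measurableSet_exists_lt_stormAt t fun j => c * n * z j
  have hpre : {x : Storm d | ε / (c * n) ≤ x.1 ∧ ∃ j, z j < stormAt x (t j)} =
      Prod.map (fun u => c * n * u) id ⁻¹'
        ({x | ∃ j, c * n * z j < stormAt x (t j)} ∩ Ici ε ×ˢ univ) := by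
    ext x
    simp only [mem_ofPred_eq, mem_preimage, mem_inter_iff, mem_prod, mem_Ici, mem_univ, and_true,
      Prod.map_fst, stormAt, Prod.map_snd, id_eq]
    rw [and_comm, div_le_iff₀ hr, mul_comm x.1]
    refine and_congr_left fun _ => exists_congr fun j => ?_
    rw [mul_assoc (c * n), mul_lt_mul_iff_right₀ hr]
  have hm : MeasurableSet (Ici ε ×ˢ (univ : Set (𝔼 d × C(𝔼 d, ℝ≥0)))) :=
    measurableSet_Ici.prod MeasurableSet.univ
  rw [hpre, m3Intensity, ← Measure.map_apply
    ((measurable_const_mul _).prodMap measurable_id) (hB.inter hm),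
    ← Measure.map_prod_map _ _ (measurable_const_mul _) measurable_id,
    map_mul_left_frechetIntensity hr, Measure.map_id, ← Measure.restrict_apply hB,
    ← Measure.prod_restrict, Measure.restrict_univ, Measure.restrict_smul, truncatedIntensity,
    Measure.prod_smul_left, Measure.prod_smul_left, Measure.smul_apply, Measure.smul_apply,
    smul_eq_mul, smul_eq_mul, ← mul_assoc, mul_comm c, ENNReal.ofReal_mul (Nat.cast_nonneg n),
    ENNReal.ofReal_natCast]

end Intensity

/-! ### Almost sure properties of the storms -/

section Storms

variable {d : ℕ}

local notation:max "𝔼" d:max => EuclideanSpace ℝ (Fin d)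

theorem ae_fewAboveOn {Ω : Type*} [MeasurableSpace Ω] {P : Measure Ω} {μ : Measure (Storm d)}
    {X : ℕ → Ω → Storm d} (hX : IsPoissonPointProcess P μ X) {K : Set 𝔼 d}
    (hK : ∀ η : ℝ, 0 < η → μ {x | ∃ s ∈ K, η < stormAt x s} ≠ ∞) :
    ∀ᵐ ω ∂P, FewAboveOn (fun i => stormAt (X i ω)) K := by
  have h : ∀ᵐ ω ∂P, ∀ m : ℕ,
      {i | X i ω ∈ {x | ∃ s ∈ K, 1 / ((m : ℝ) + 1) < stormAt x s}}.Finite :=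
    ae_all_iff.2 fun m =>
      hX.ae_finite (measurableSet_storm_exceeds K _) (hK _ Nat.one_div_pos_of_nat)
  filter_upwards [h] with ω hω η hη
  obtain ⟨m, hm⟩ := exists_nat_one_div_lt hη
  exact (hω m).subset fun i ⟨s, hs, hi⟩ => ⟨s, hs, hm.trans hi⟩

theorem ae_forall_compact_fewAboveOn {Ω : Type*} [MeasurableSpace Ω] {P : Measure Ω}
    {μ : Measure (Storm d)} {X : ℕ → Ω → Storm d} (hX : IsPoissonPointProcess P μ X)
    (hK : ∀ K : Set 𝔼 d, IsCompact K →
      ∀ η : ℝ, 0 < η → μ {x | ∃ s ∈ K, η < stormAt x s} ≠ ∞) :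
    ∀ᵐ ω ∂P, ∀ K, IsCompact K → FewAboveOn (fun i => stormAt (X i ω)) K := by
  have h : ∀ᵐ ω ∂P, ∀ m : ℕ,
      FewAboveOn (fun i => stormAt (X i ω)) (Metric.closedBall (0 : 𝔼 d) m) :=
    ae_all_iff.2 fun m => ae_fewAboveOn hX (hK _ (isCompact_closedBall _ _))
  filter_upwards [h] with ω hω K hKc
  obtain ⟨r, hr⟩ := hKc.isBounded.subset_closedBall (0 : 𝔼 d)
  obtain ⟨m, hm⟩ := exists_nat_ge r
  exact (hω m).mono (hr.trans (Metric.closedBall_subset_closedBall hm))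
    fun i s => le_max_right _ _

theorem ae_pos_of_m3Intensity {Ω : Type*} [MeasurableSpace Ω] {P : Measure Ω}
    [IsProbabilityMeasure P] {PF : Measure C(𝔼 d, ℝ≥0)} [SFinite PF] {X : ℕ → Ω → Storm d}
    (hX : IsPoissonPointProcess P (m3Intensity PF) X) : ∀ᵐ ω ∂P, ∀ i, 0 < (X i ω).1 := by
  have hm : MeasurableSet {x : Storm d | x.1 ≤ 0} := measurableSet_le measurable_fst measurable_const
  filter_upwards [hX.ae_forall_notMem hm (m3Intensity_nonpos PF)] with ω hω i
  exact not_le.1 (hω i)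

theorem ae_le_of_truncatedIntensity {Ω : Type*} [MeasurableSpace Ω] {P : Measure Ω}
    [IsProbabilityMeasure P] {c ε : ℝ} {PF : Measure C(𝔼 d, ℝ≥0)} [SFinite PF]
    {Y : ℕ → Ω → Storm d} (hY : IsPoissonPointProcess P (truncatedIntensity c ε PF) Y) :
    ∀ᵐ ω ∂P, ∀ i, ε ≤ (Y i ω).1 := by
  have hm : MeasurableSet {x : Storm d | x.1 < ε} := measurableSet_lt measurable_fst measurable_const
  filter_upwards [hY.ae_forall_notMem hm (truncatedIntensity_lt c ε PF)] with ω hω i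
  exact not_lt.1 (hω i)

theorem truncatedIntensity_ne_top {c ε : ℝ} {PF : Measure C(𝔼 d, ℝ≥0)} [SFinite PF]
    {B : Set (Storm d)} (h : m3Intensity PF B ≠ ∞) : truncatedIntensity c ε PF B ≠ ∞ :=
  ne_top_of_le_ne_top (by simpa using ENNReal.mul_ne_top ENNReal.ofReal_ne_top h)
    (truncatedIntensity_le c ε PF B)

variable {S : Type*} [MeasurableSpace S] {ρ : Measure S} {F : S → C(𝔼 d, ℝ≥0)}

/-- Invariance of Lebesgue measure under `t ↦ s - t` gives `∫ E F(s - t) dt = E ∫ F = 1`. The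
singleton matches `FewAboveOn`. -/
theorem IsShapeFunction.m3Intensity_ne_top [SFinite ρ] (hF : IsShapeFunction ρ F) (s : 𝔼 d)
    {η : ℝ} (hη : 0 < η) :
    m3Intensity (ρ.map F) {x | ∃ s' ∈ ({s} : Set 𝔼 d), η < stormAt x s'} ≠ ∞ := by
  refine m3Intensity_exceeds_ne_top (PF := ρ.map F) ?_ hη
  have hm : Measurable fun y : 𝔼 d × C(𝔼 d, ℝ≥0) => (y.2 (s - y.1) : ℝ≥0∞) :=
    Continuous.measurable (by fun_prop)
  have hm' : Measurable fun y : C(𝔼 d, ℝ≥0) × 𝔼 d => (y.1 y.2 : ℝ≥0∞) :=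
    Continuous.measurable (by fun_prop)
  simp only [iSup_singleton]
  rw [lintegral_lintegral_swap hm.aemeasurable]
  have hinv (f : C(𝔼 d, ℝ≥0)) : ∫⁻ t, (f (s - t) : ℝ≥0∞) = ∫⁻ t, (f t : ℝ≥0∞) :=
    lintegral_sub_left_eq_self (fun t => (f t : ℝ≥0∞)) s
  simp_rw [hinv]
  rw [lintegral_map hm'.lintegral_prod_right hF.1, hF.2]
  exact ENNReal.one_lt_top

theorem SupIntegrable.m3Intensity_ne_top [SFinite ρ] (hF : Measurable F)
    (h : SupIntegrable ρ F) (K : Set 𝔼 d) (hK : IsCompact K) (η : ℝ) (hη : 0 < η) :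
    m3Intensity (ρ.map F) {x | ∃ s ∈ K, η < stormAt x s} ≠ ∞ := by
  refine m3Intensity_exceeds_ne_top (PF := ρ.map F) (lt_of_eq_of_lt (lintegral_congr fun t => ?_) (h K hK)) hη
  exact lintegral_map ((measurable_iSup_shape K).comp measurable_prodMk_left) hF

/-! ### The law of the normalized maxima -/

/-- The norming constants `1 / (c n)`. -/
noncomputable def maxScale (c : ℝ) (n : ℕ) : ℝ := if n = 0 then 1 else (c * n)⁻¹

/-- The definition of the domain of attraction asks for positivity at `n = 0` too, hence the
separate value there. -/
theorem maxScale_pos {c : ℝ} (hc : 0 < c) (n : ℕ) : 0 < maxScale c n := by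
  unfold maxScale
  split_ifs with hn
  · exact one_pos
  · exact inv_pos.2 (mul_pos hc (by exact_mod_cast Nat.pos_of_ne_zero hn))

theorem measurable_normalizedMax {Ω T : Type*} [MeasurableSpace Ω] {η : Ω → T → ℝ}
    (hη : ∀ t, Measurable fun ω => η ω t) (b c : ℕ → T → ℝ) (n : ℕ) (t : T) :
    Measurable fun ω : Fin n → Ω => normalizedMax η b c n ω t :=
  ((Measurable.iSup fun i => (hη t).comp (measurable_pi_apply i)).sub_const _).const_mul _

variable {Ω₀ : Type*} [MeasurableSpace Ω₀] {P₀ : Measure Ω₀} [IsProbabilityMeasure P₀]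
  {X : ℕ → Ω₀ → Storm d} {c ε κ : ℝ} {Ω : Type*} [MeasurableSpace Ω] {P : Measure Ω}
  [IsProbabilityMeasure P] {Y : ℕ → Ω → Storm d} {PF : Measure C(𝔼 d, ℝ≥0)} [SFinite PF]

/-- The superposition of `n` copies is never formed: independence gives the `n`-th power of one void
probability, and `exp(-a)^n = exp(-n a)` is the void probability of the rescaled cut process. -/
theorem map_normalizedMax_eq_map_cutStormMax
    (hX : IsPoissonPointProcess P₀ (m3Intensity PF) X)
    (hY : IsPoissonPointProcess P (truncatedIntensity c ε PF) Y)
    (hfin : ∀ (s : 𝔼 d) (η : ℝ), 0 < η →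
      m3Intensity PF {x | ∃ s' ∈ ({s} : Set 𝔼 d), η < stormAt x s'} ≠ ∞)
    (hc : 0 < c) (hκ : 0 < κ) {n : ℕ} (hn : n ≠ 0) {ι : Type*} [Finite ι] (t : ι → 𝔼 d) :
    (Measure.pi fun _ : Fin n => P).map
        (fun ω j => normalizedMax (fun ω s => max κ (stormMax Y ω s)) 0
          (fun n _ => maxScale c n) n ω (t j)) =
      P₀.map (fun ω j => cutStormMax (ε / (c * n)) (κ / (c * n)) (fun i => X i ω) (t j)) := by
  have hr : 0 < c * n := mul_pos hc (by exact_mod_cast Nat.pos_of_ne_zero hn)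
  have : Nonempty (Fin n) := ⟨⟨0, Nat.pos_of_ne_zero hn⟩⟩
  have hηm : ∀ s, Measurable fun ω => max κ (stormMax Y ω s) := fun s =>
    measurable_const.max (measurable_stormMax hY.measurable_point s)
  have hm1 : Measurable fun (ω : Fin n → Ω) (j : ι) => normalizedMax
      (fun ω s => max κ (stormMax Y ω s)) 0 (fun n _ => maxScale c n) n ω (t j) :=
    measurable_pi_lambda _ fun j => measurable_normalizedMax hηm _ _ _ _
  have hm2 : Measurable fun (ω : Ω₀) (j : ι) =>
      cutStormMax (ε / (c * n)) (κ / (c * n)) (fun i => X i ω) (t j) :=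
    measurable_pi_lambda _ fun j => measurable_cutStormMax hX.measurable_point _ _ _
  have := Measure.isProbabilityMeasure_map (μ := Measure.pi fun _ : Fin n => P) hm1.aemeasurable
  have := Measure.isProbabilityMeasure_map (μ := P₀) hm2.aemeasurable
  refine measure_ext_of_Iic_box fun z => ?_
  have hbox : MeasurableSet {x : ι → ℝ | ∀ j, x j ≤ z j} := by
    have : {x : ι → ℝ | ∀ j, x j ≤ z j} = Iic z := rfl
    rw [this]
    exact isClosed_Iic.measurableSet
  rw [Measure.map_apply hm1 hbox, Measure.map_apply hm2 hbox]
  have hpi : (fun (ω : Fin n → Ω) (j : ι) => normalizedMax (fun ω s => max κ (stormMax Y ω s)) 0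
      (fun n _ => maxScale c n) n ω (t j)) ⁻¹' {x | ∀ j, x j ≤ z j} =
      univ.pi fun _ => {ω | ∀ j, max κ (stormMax Y ω (t j)) ≤ c * n * z j} := by
    ext ω
    simp only [mem_preimage, mem_ofPred_eq, mem_univ_pi, normalizedMax, maxScale, if_neg hn,
      Pi.zero_apply, sub_zero]
    rw [forall_comm]
    refine forall_congr' fun j => ?_
    rw [inv_mul_le_iff₀ hr, ciSup_le_iff (finite_range _).bddAbove]
  rw [hpi, Measure.pi_pi, Finset.prod_const, Finset.card_univ, Fintype.card_fin]
  have hbX : ∀ᵐ ω ∂P₀, ∀ j, BddAbove (range fun i => stormAt (X i ω) (t j)) :=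
    ae_all_iff.2 fun j => by
      filter_upwards [ae_fewAboveOn hX (hfin (t j))] with ω hω using hω.bddAbove rfl
  have hbY : ∀ᵐ ω ∂P, ∀ j, BddAbove (range fun i => stormAt (Y i ω) (t j)) :=
    ae_all_iff.2 fun j => by
      filter_upwards [ae_fewAboveOn hY fun η hη => truncatedIntensity_ne_top (hfin (t j) η hη)]
        with ω hω using hω.bddAbove rfl
  -- Here every level `c * n * z j` is positive, so the exceedance sets have finite intensity;
  -- otherwise both events are empty.
  by_cases hz : ∀ j, κ ≤ c * n * z j
  · have hB := measurableSet_exists_lt_stormAt t fun j => c * n * z j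
    have hB' : MeasurableSet {x : Storm d | ε / (c * n) ≤ x.1 ∧ ∃ j, z j < stormAt x (t j)} :=
      (measurableSet_le measurable_const measurable_fst).inter
        (measurableSet_exists_lt_stormAt t z)
    have hBfin : truncatedIntensity c ε PF {x | ∃ j, c * n * z j < stormAt x (t j)} ≠ ∞ := by
      refine truncatedIntensity_ne_top (ne_of_lt ?_)
      simp only [ofPred_exists]
      rw [← biUnion_univ]
      refine measure_biUnion_lt_top finite_univ fun j _ => ?_
      simpa using (hfin (t j) _ (hκ.trans_le (hz j))).lt_top
    have hscale := m3Intensity_scaling (ε := ε) hc hn PF t z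
    have hB'fin : m3Intensity PF {x | ε / (c * n) ≤ x.1 ∧ ∃ j, z j < stormAt x (t j)} ≠ ∞ :=
      hscale ▸ ENNReal.mul_ne_top (ENNReal.natCast_ne_top n) hBfin
    have hG : ({ω | ∀ j, max κ (stormMax Y ω (t j)) ≤ c * n * z j} : Set Ω) =ᵐ[P]
        {ω | ∀ i, Y i ω ∉ {x | ∃ j, c * n * z j < stormAt x (t j)}} := by
      filter_upwards [hbY] with ω hω
      refine propext ?_
      change (∀ j, max κ (stormMax Y ω (t j)) ≤ c * n * z j) ↔
        ∀ i, ¬ ∃ j, c * n * z j < stormAt (Y i ω) (t j)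
      push Not
      rw [forall_comm]
      refine forall_congr' fun j => ?_
      rw [max_le_iff, and_iff_right (hz j), stormMax, ciSup_le_iff (hω j)]
    have hG' : ((fun (ω : Ω₀) (j : ι) =>
        cutStormMax (ε / (c * n)) (κ / (c * n)) (fun i => X i ω) (t j)) ⁻¹'
          {x | ∀ j, x j ≤ z j} : Set Ω₀) =ᵐ[P₀]
        {ω | ∀ i, X i ω ∉ {x | ε / (c * n) ≤ x.1 ∧ ∃ j, z j < stormAt x (t j)}} := by
      filter_upwards [hbX] with ω hω
      refine propext ?_
      change (∀ j, cutStormMax (ε / (c * n)) (κ / (c * n)) (fun i => X i ω) (t j) ≤ z j) ↔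
        ∀ i, ¬ (ε / (c * n) ≤ (X i ω).1 ∧ ∃ j, z j < stormAt (X i ω) (t j))
      simp_rw [← exists_and_left, not_exists]
      rw [forall_comm]
      refine forall_congr' fun j => ?_
      rw [cutStormMax_le_iff (div_pos hκ hr) (hω j), and_iff_right]
      rw [div_le_iff₀ hr, mul_comm]
      exact hz j
    rw [measure_congr hG, measure_congr hG', hY.measure_forall_notMem hB hBfin,
      hX.measure_forall_notMem hB' hB'fin, hscale, ← ENNReal.ofReal_pow (Real.exp_pos _).le,
      ← Real.exp_nat_mul, ENNReal.toReal_mul, ENNReal.toReal_natCast, mul_neg]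
  · push Not at hz
    obtain ⟨j, hj⟩ := hz
    have h1 : {ω | ∀ j, max κ (stormMax Y ω (t j)) ≤ c * n * z j} = ∅ :=
      eq_empty_of_forall_notMem fun ω hω => (((le_max_left _ _).trans (hω j)).trans_lt hj).false
    have h2 : (fun (ω : Ω₀) (j : ι) =>
        cutStormMax (ε / (c * n)) (κ / (c * n)) (fun i => X i ω) (t j)) ⁻¹'
          {x | ∀ j, x j ≤ z j} = ∅ := by
      refine eq_empty_of_forall_notMem fun ω hω => ?_
      have h3 : κ / (c * n) ≤ z j := (le_max_left _ _).trans (hω j)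
      rw [div_le_iff₀ hr, mul_comm] at h3
      exact (h3.trans_lt hj).false
    rw [h1, h2, measure_empty, measure_empty, zero_pow hn]

end Storms

/-! ### Convergence in distribution -/

/-- Convergence in distribution sees only laws, so variables on changing spaces may be exchanged for
coupled ones. -/
theorem tendstoInDistribution_of_eventually_map_eq {A Ω' : Type*} {Ω : ℕ → Type*}
    [TopologicalSpace A] [MeasurableSpace A] [OpensMeasurableSpace A]
    [∀ n, MeasurableSpace (Ω n)] [MeasurableSpace Ω'] {P : ∀ n, Measure (Ω n)}
    [∀ n, IsProbabilityMeasure (P n)] {Q : Measure Ω'} [IsProbabilityMeasure Q]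
    {Z : ∀ n, Ω n → A} {W : ℕ → Ω' → A} {ξ : Ω' → A} (hZ : ∀ n, AEMeasurable (Z n) (P n))
    (hW : TendstoInDistribution W atTop ξ (fun _ => Q) Q)
    (h : ∀ᶠ n in atTop, (P n).map (Z n) = Q.map (W n)) :
    TendstoInDistribution Z atTop ξ P Q where
  forall_aemeasurable := hZ
  aemeasurable_limit := hW.aemeasurable_limit
  tendsto := hW.tendsto.congr' (h.mono fun _ hn => Subtype.ext hn.symm)

/-- A process whose paths are almost surely continuous has a version in `C(T, ℝ)`. -/
theorem exists_measurable_continuousMap {Ω T : Type*} [MeasurableSpace Ω] [TopologicalSpace T]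
    [SecondCountableTopology T] [LocallyCompactSpace T] {P : Measure Ω} {Z : Ω → T → ℝ}
    (hm : ∀ t, Measurable fun ω => Z ω t) (hc : ∀ᵐ ω ∂P, Continuous (Z ω)) :
    ∃ Zc : Ω → C(T, ℝ), Measurable Zc ∧ ∀ᵐ ω ∂P, ∀ t, Zc ω t = Z ω t := by
  classical
  obtain ⟨G, hG, hGm, hGc⟩ := hc.exists_measurable_mem
  refine ⟨fun ω => if h : ω ∈ G then ⟨Z ω, hGc ω h⟩ else 0,
    measurable_continuousMap_of_eval fun t => ?_, ?_⟩
  · have : (fun ω => (if h : ω ∈ G then ⟨Z ω, hGc ω h⟩ else 0 : C(T, ℝ)) t) =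
        fun ω => if ω ∈ G then Z ω t else 0 := by
      ext ω
      split_ifs <;> rfl
    rw [this]
    exact Measurable.ite hGm (hm t) measurable_const
  · filter_upwards [hG] with ω hω t
    rw [dif_pos hω]
    rfl

theorem continuous_normalizedMax {Ω T : Type*} [TopologicalSpace T]
    [WeaklyLocallyCompactSpace T] {η : Ω → T → ℝ} {b c : ℕ → T → ℝ} {n : ℕ} {ω : Fin n → Ω}
    (hη : ∀ i, Continuous (η (ω i))) (hη0 : ∀ i t, 0 ≤ η (ω i) t)
    (hb : Continuous (b n)) (hc : Continuous (c n)) :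
    Continuous (normalizedMax η b c n ω) := by
  refine hc.mul (Continuous.sub ?_ hb)
  -- For `n = 0` the empty supremum is the constant `0`.
  rcases isEmpty_or_nonempty (Fin n) with h | h
  · simp only [Real.iSup_of_isEmpty]
    exact continuous_const
  · exact continuous_iSup_of_fewAboveOn hη hη0 fun K _ η _ => toFinite _

theorem tendsto_div_mul_natCast_atTop {c : ℝ} (hc : 0 < c) (a : ℝ) :
    Tendsto (fun n : ℕ => a / (c * n)) atTop (𝓝 0) :=
  Tendsto.const_div_atTop (tendsto_natCast_atTop_atTop.const_mul_atTop hc) a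

theorem mainTheorem9 {d : ℕ} (hd : 1 ≤ d)
    -- the random shape function
    {S : Type*} [MeasurableSpace S] (ρ : Measure S) [IsProbabilityMeasure ρ]
    (F : S → C(EuclideanSpace ℝ (Fin d), ℝ≥0)) (hF : IsShapeFunction ρ F)
    -- the mixed moving maxima process `M = stormMax X` with shape function `F`
    {Ω₀ : Type*} [MeasurableSpace Ω₀] (P₀ : Measure Ω₀) [IsProbabilityMeasure P₀]
    (X : ℕ → Ω₀ → Storm d) (hX : IsPoissonPointProcess P₀ (m3Intensity (ρ.map F)) X)
    -- the point process in the definition of the process `κ ∨ stormMax Y`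
    (c ε κ : ℝ) (hc : 0 < c) (hε : 0 < ε) (hκ : 0 < κ)
    {Ω : Type*} [MeasurableSpace Ω] (P : Measure Ω) [IsProbabilityMeasure P]
    (Y : ℕ → Ω → Storm d)
    (hY : IsPoissonPointProcess P (truncatedIntensity c ε (ρ.map F)) Y) :
    -- both maxima are almost surely finite at every fixed site
    (∀ s, ∀ᵐ ω ∂P₀, BddAbove (range fun i => stormAt (X i ω) s)) ∧
    (∀ s, ∀ᵐ ω ∂P, BddAbove (range fun i => stormAt (Y i ω) s)) ∧
    InMDAFinDim (fun ω s => max κ (stormMax Y ω s)) P (stormMax X) P₀ ∧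
    (SupIntegrable ρ F →
      (∀ᵐ ω ∂P₀, ∀ s, BddAbove (range fun i => stormAt (X i ω) s)) ∧
      (∀ᵐ ω ∂P, ∀ s, BddAbove (range fun i => stormAt (Y i ω) s)) ∧
      InMDAWeaklyOnC (fun ω s => max κ (stormMax Y ω s)) P (stormMax X) P₀) := by 
  have hPF : IsProbabilityMeasure (ρ.map F) := Measure.isProbabilityMeasure_map hF.1.aemeasurable
  have hfin := fun s η (hη : 0 < η) => hF.m3Intensity_ne_top s hη
  have hlaw {n : ℕ} (hn : n ≠ 0) {ι : Type} [Finite ι] (t : ι → EuclideanSpace ℝ (Fin d)) :=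
    map_normalizedMax_eq_map_cutStormMax hX hY hfin hc hκ hn t
  have hXpos := ae_pos_of_m3Intensity hX
  have hκ0 : ∀ n : ℕ, 0 ≤ κ / (c * n) := fun n => by positivity
  have hηm : ∀ s, Measurable fun ω => max κ (stormMax Y ω s) := fun s =>
    measurable_const.max (measurable_stormMax hY.measurable_point s)
  refine ⟨fun s => ?_, fun s => ?_, ?_, fun hS => ?_⟩
  · filter_upwards [ae_fewAboveOn hX (hfin s)] with ω hω using hω.bddAbove rfl
  · filter_upwards [ae_fewAboveOn hY fun η hη => truncatedIntensity_ne_top (hfin s η hη)]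
      with ω hω using hω.bddAbove rfl
  · refine ⟨0, fun n _ => maxScale c n, fun n _ => maxScale_pos hc n, fun k t => ?_⟩
    refine tendstoInDistribution_of_eventually_map_eq
      (W := fun n ω j => cutStormMax (ε / (c * n)) (κ / (c * n)) (fun i => X i ω) (t j))
      (fun n => (measurable_pi_lambda _ fun j =>
        measurable_normalizedMax hηm _ _ _ _).aemeasurable) ?_
      ((eventually_ne_atTop 0).mono fun n hn => hlaw hn t)
    refine tendstoInDistribution_of_ae_tendsto
      (fun n => (measurable_pi_lambda _ fun j =>
        measurable_cutStormMax hX.measurable_point _ _ _).aemeasurable)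
      (measurable_pi_lambda _ fun j => measurable_stormMax hX.measurable_point _).aemeasurable ?_
    -- Uniform convergence on the singletons `{t j}` is all that is needed here.
    filter_upwards [hXpos, ae_all_iff.2 fun j => ae_fewAboveOn hX (hfin (t j))] with ω hpos hω
    exact tendsto_pi_nhds.2 fun j => (tendstoUniformlyOn_cutStormMax hpos (hω j)
      (tendsto_div_mul_natCast_atTop hc ε) (tendsto_div_mul_natCast_atTop hc κ) hκ0).tendsto_at rfl
  · have hXfew := ae_forall_compact_fewAboveOn hX (hS.m3Intensity_ne_top hF.1)
    have hYfew := ae_forall_compact_fewAboveOn hY fun K hK η hη =>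
      truncatedIntensity_ne_top (hS.m3Intensity_ne_top hF.1 K hK η hη)
    refine ⟨?_, ?_, 0, fun n _ => maxScale c n, fun n _ => maxScale_pos hc n, ?_⟩
    · filter_upwards [hXfew] with ω hω s using (hω {s} isCompact_singleton).bddAbove rfl
    · filter_upwards [hYfew] with ω hω s using (hω {s} isCompact_singleton).bddAbove rfl
    · have hηc : ∀ᵐ ω ∂P, Continuous fun s => max κ (stormMax Y ω s) := by
        filter_upwards [hYfew, ae_le_of_truncatedIntensity hY] with ω hω hpos
        exact continuous_const.max (continuous_iSup_stormAt (fun i => hε.trans_le (hpos i)) hω)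
      have hZc (n : ℕ) : ∀ᵐ ω ∂(Measure.pi fun _ : Fin n => P), Continuous
          (normalizedMax (fun ω s => max κ (stormMax Y ω s)) 0 (fun n _ => maxScale c n) n ω) := by
        have : ∀ᵐ ω ∂(Measure.pi fun _ : Fin n => P), ∀ i,
            Continuous fun s => max κ (stormMax Y (ω i) s) := ae_all_iff.2 fun i =>
          (measurePreserving_eval (fun _ : Fin n => P) i).quasiMeasurePreserving.ae hηc
        filter_upwards [this] with ω hω
        exact continuous_normalizedMax hω (fun i t => hκ.le.trans (le_max_left _ _))
          continuous_const continuous_const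
      have hWc (n : ℕ) : ∀ᵐ ω ∂P₀,
          Continuous (cutStormMax (ε / (c * n)) (κ / (c * n)) fun i => X i ω) := by
        filter_upwards [hXfew, hXpos] with ω hω hpos using continuous_cutStormMax _ _ hpos hω
      have hξc : ∀ᵐ ω ∂P₀, Continuous (stormMax X ω) := by
        filter_upwards [hXfew, hXpos] with ω hω hpos using continuous_iSup_stormAt hpos hω
      -- `Zc` are the normalized maxima, `Wc` their coupled counterparts on `Ω₀`, as random elements
      -- of `C(ℝ^d)`.
      choose Zc hZcm hZca using fun n => exists_measurable_continuousMap
        (fun t => measurable_normalizedMax hηm 0 (fun n _ => maxScale c n) n t) (hZc n)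
      choose Wc hWcm hWca using fun n => exists_measurable_continuousMap
        (fun t => measurable_cutStormMax hX.measurable_point _ _ t) (hWc n)
      obtain ⟨ξc, hξcm, hξca⟩ := exists_measurable_continuousMap
        (fun t => measurable_stormMax hX.measurable_point t) hξc
      refine ⟨Zc, ξc, hZca, hξca, tendstoInDistribution_of_eventually_map_eq
        (W := Wc) (fun n => (hZcm n).aemeasurable) ?_ ?_⟩
      · refine tendstoInDistribution_of_ae_tendsto (fun n => (hWcm n).aemeasurable)
          hξcm.aemeasurable ?_
        filter_upwards [hXpos, hXfew, ae_all_iff.2 hWca, hξca] with ω hpos hω hW hξ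
        rw [ContinuousMap.tendsto_iff_forall_isCompact_tendstoUniformlyOn]
        intro K hK
        have h := tendstoUniformlyOn_cutStormMax hpos (hω K hK)
          (tendsto_div_mul_natCast_atTop hc ε) (tendsto_div_mul_natCast_atTop hc κ) hκ0
        exact (h.congr (Eventually.of_forall fun n s _ => (hW n s).symm)).congr_right
          fun s _ => (hξ s).symm
      · filter_upwards [eventually_ne_atTop 0] with n hn
        have := Measure.isProbabilityMeasure_map (μ := Measure.pi fun _ : Fin n => P)
          (hZcm n).aemeasurable
        -- The finite-dimensional identity `hlaw` lifts to an equality of laws on path space.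
        refine continuousMap_measure_ext fun I => ?_
        have hI : Measurable fun (f : C(EuclideanSpace ℝ (Fin d), ℝ)) (t : I) => f t :=
          (Finset.measurable_restrict I).comp measurable_continuousMap_coe
        rw [Measure.map_map hI (hZcm n), Measure.map_map hI (hWcm n)]
        refine Eq.trans (Measure.map_congr ?_) ((hlaw hn fun t : I => (t : _)).trans
          (Measure.map_congr ?_))
        · filter_upwards [hZca n] with ω hω
          exact funext fun t => hω t
        · filter_upwards [hWca n] with ω hω
          exact funext fun t => (hω t).symm
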